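/- For $n\ge 1$ let $p_n$ denote the $n$-th prime number, so that $p_1=2$, $p_2=3$, and so on. Then \[\lim_{n\to\infty}\frac{\log n}{p_n-p_{n+1}}\left(\frac1{p_{n+1}}\sum_{m=1}^{n}p_m-\frac1{p_n}\sum_{m=1}^{n}p_m\right)=\frac12,\] or, equivalently, \[\lim_{n\to\infty}\frac{\log n}{p_n\,p_{n+1}}\sum_{m=1}^{n}p_m=\frac12.\] -/

import Mathlib

/-- The `n`-th prime number, counted from one: `nthPrime 1 = 2`, `nthPrime 2 = 3`, and so on.
Only the values at `n ≥ 1` are meaningful. -/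
noncomputable def nthPrime (n : ℕ) : ℕ := Nat.nth Nat.Prime (n - 1)

/-- The sum `p_1 + ⋯ + p_n` of the first `n` primes, as a real number. -/
noncomputable def primeSum (n : ℕ) : ℝ := ∑ m ∈ Finset.Icc 1 n, (nthPrime m : ℝ)

open MeasureTheory Filter Topology Complex Asymptotics

/-! Since 1/p_{n+1} - 1/p_n = (p_n - p_{n+1})/(p_n p_{n+1}), the two expressions agree, and
everything rests on p_n ~ n log n (`nthPrime_isEquivalent`). It gives p_{n+1} ~ n log n and, by
summation, p_1 + ⋯ + p_n ~ n² log n / 2 (`primeSum_isEquivalent`); the quotient is then asymptotic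
to log n · (n² log n / 2) / (n log n)² = 1/2.

The asymptotic for p_n is the prime number theorem evaluated at p_n, and that theorem is derived
from ψ(x) ~ x. Put g(u) = ψ(e^u) e^{-u}, which is bounded by Chebyshev's estimate. The Laplace
transform of g - 1 extends continuously to Re z ≥ 0; this is where the nonvanishing of ζ on Re s = 1
enters. By Riemann–Lebesgue, averages of g against rescaled Fejér kernels tend to the mass of the
kernel (`tendsto_integral_comp_sub_mul_kernel`), and monotonicity of g(u) e^u turns these averages
into pointwise bounds (`tendsto_one_of_laplace_continuousOn`). -/

/-! ### Boundary values of Laplace transforms -/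

/-- Wiener–Ikehara argument: if the Laplace transform of a bounded function `f` extends
continuously to the closed half-plane, then the averages of `f` against the translates of an
integrable kernel with compactly supported spectrum vanish at infinity. -/
theorem tendsto_setIntegral_mul_kernel_of_laplace_continuousOn
    {f : ℝ → ℂ} (hfm : Measurable f) {M : ℝ} (hfM : ∀ u, ‖f u‖ ≤ M)
    {H : ℂ → ℂ} (hH : ContinuousOn H {z | 0 ≤ z.re})
    (hfH : ∀ z : ℂ, 0 < z.re → ∫ u in Set.Ioi (0 : ℝ), f u * exp (-z * u) = H z)
    {φ : ℝ → ℂ} (hφ : Continuous φ) (hφc : HasCompactSupport φ)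
    {k : ℝ → ℂ} (hk : Integrable k) (hkφ : ∀ x : ℝ, ∫ t : ℝ, φ t * exp (I * t * x) = k x) :
    Tendsto (fun v : ℝ => ∫ u in Set.Ioi (0 : ℝ), f u * k (v - u)) atTop (𝓝 0) := by
  -- Fubini in the open half-plane
  have hfub : ∀ v ε : ℝ, 0 < ε →
      ∫ t : ℝ, φ t * H (ε + I * t) * exp (I * t * v) =
        ∫ u in Set.Ioi (0 : ℝ), f u * exp (-ε * u) * k (v - u) := by
    intro v ε hε
    have hint : Integrable (Function.uncurry fun (t u : ℝ) =>
        φ t * exp (I * t * v) * (f u * exp (-(ε + I * t) * u)))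
        (volume.prod (volume.restrict (Set.Ioi (0 : ℝ)))) := by
      have hexp : IntegrableOn (fun u : ℝ => M * Real.exp (-ε * u)) (Set.Ioi 0) :=
        (integrableOn_exp_mul_Ioi (neg_lt_zero.mpr hε) 0).const_mul M
      have hφi : Integrable fun t => ‖φ t‖ := (hφ.integrable_of_hasCompactSupport hφc).norm
      refine (hφi.mul_prod hexp).mono' ?_ ?_
      · refine Measurable.aestronglyMeasurable ?_
        have := hφ.measurable
        simp only [Function.uncurry_def]
        fun_prop
      · refine Eventually.of_forall fun p => ?_
        simp only [Function.uncurry_def, norm_mul, norm_exp]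
        have h1 : (I * (p.1 : ℂ) * (v : ℂ)).re = 0 := by simp
        have h2 : (-((ε : ℂ) + I * (p.1 : ℂ)) * (p.2 : ℂ)).re = -ε * p.2 := by simp
        rw [h1, h2, Real.exp_zero, mul_one]
        gcongr
        exact hfM _
    calc ∫ t : ℝ, φ t * H (ε + I * t) * exp (I * t * v)
        = ∫ t : ℝ, ∫ u in Set.Ioi (0 : ℝ),
            φ t * exp (I * t * v) * (f u * exp (-(ε + I * t) * u)) := by
          refine integral_congr_ae (Eventually.of_forall fun t => ?_)
          simp only
          rw [integral_const_mul, hfH _ (by simpa using hε)]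
          ring
      _ = ∫ u in Set.Ioi (0 : ℝ), ∫ t : ℝ,
            φ t * exp (I * t * v) * (f u * exp (-(ε + I * t) * u)) := integral_integral_swap hint
      _ = _ := by
          refine integral_congr_ae (Eventually.of_forall fun u => ?_)
          simp only
          rw [← hkφ, ← integral_const_mul]
          refine integral_congr_ae (Eventually.of_forall fun t => ?_)
          simp only
          have : exp (I * t * v) * exp (-(ε + I * t) * u) =
              exp (-ε * u) * exp (I * t * (v - u : ℝ)) := by
            rw [← exp_add, ← exp_add]; congr 1; push_cast; ring
          calc _ = φ t * f u * (exp (I * t * v) * exp (-(ε + I * t) * u)) := by ring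
            _ = _ := by rw [this]; ring
  let e : ℕ → ℝ := fun n => 1 / ((n : ℝ) + 1)
  have he0 : ∀ n, 0 < e n := fun n => by positivity
  have he1 : ∀ n, e n ≤ 1 := fun n => by
    rw [div_le_one (by positivity)]; linarith [(Nat.cast_nonneg n : (0 : ℝ) ≤ n)]
  have helim : Tendsto e atTop (𝓝 0) := tendsto_one_div_add_atTop_nhds_zero_nat
  -- the identity on the boundary line
  have hbd : ∀ v : ℝ, ∫ t : ℝ, φ t * H (I * t) * exp (I * t * v) =
      ∫ u in Set.Ioi (0 : ℝ), f u * k (v - u) := by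
    intro v
    -- Compactness of [0, 1] × supp φ supplies the dominating constant for ε → 0.
    obtain ⟨C, hC⟩ : ∃ C : ℝ, ∀ ε ∈ Set.Icc (0 : ℝ) 1, ∀ t ∈ tsupport φ, ‖H (ε + I * t)‖ ≤ C := by
      have hcomp : IsCompact (Set.Icc (0 : ℝ) 1 ×ˢ tsupport φ) := isCompact_Icc.prod hφc
      have hcont : ContinuousOn (fun p : ℝ × ℝ => H (p.1 + I * p.2))
          (Set.Icc (0 : ℝ) 1 ×ˢ tsupport φ) := by
        refine hH.comp (by fun_prop) ?_
        rintro ⟨a, b⟩ ⟨ha, -⟩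
        simpa using ha.1
      obtain ⟨C, hC⟩ := hcomp.exists_bound_of_continuousOn hcont
      exact ⟨C, fun ε hε t ht => hC (ε, t) ⟨hε, ht⟩⟩
    have hL : Tendsto (fun n => ∫ t : ℝ, φ t * H (e n + I * t) * exp (I * t * v)) atTop
        (𝓝 (∫ t : ℝ, φ t * H (I * t) * exp (I * t * v))) := by
      refine tendsto_integral_of_dominated_convergence (fun t => ‖φ t‖ * C) ?_ ?_ ?_ ?_
      · intro n
        have : Continuous fun t : ℝ => H (e n + I * t) :=
          hH.comp_continuous (by fun_prop) (fun t => by simpa using (he0 n).le)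
        exact ((hφ.mul this).mul (by fun_prop)).aestronglyMeasurable
      · exact (hφ.integrable_of_hasCompactSupport hφc).norm.mul_const C
      · intro n
        refine Eventually.of_forall fun t => ?_
        rw [norm_mul, norm_mul, norm_exp]
        have h1 : (I * (t : ℂ) * (v : ℂ)).re = 0 := by simp
        rw [h1, Real.exp_zero, mul_one]
        by_cases ht : t ∈ tsupport φ
        · gcongr
          exact hC _ ⟨(he0 n).le, he1 n⟩ _ ht
        · simp [image_eq_zero_of_notMem_tsupport ht]
      · refine Eventually.of_forall fun t => ?_
        refine (Tendsto.const_mul _ ?_).mul_const _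
        have hw : Tendsto H (𝓝[{z | 0 ≤ z.re}] (I * t)) (𝓝 (H (I * t))) := hH _ (by simp)
        refine hw.comp (tendsto_nhdsWithin_iff.mpr ⟨?_, Eventually.of_forall fun n => ?_⟩)
        · have := ((continuous_ofReal.tendsto 0).comp helim).add_const (I * (t : ℂ))
          simpa using this
        · simpa using (he0 n).le
    have hR : Tendsto (fun n => ∫ u in Set.Ioi (0 : ℝ), f u * exp (-e n * u) * k (v - u)) atTop
        (𝓝 (∫ u in Set.Ioi (0 : ℝ), f u * k (v - u))) := by
      have hkv : Integrable fun u => k (v - u) := hk.comp_sub_left v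
      refine tendsto_integral_of_dominated_convergence (fun u => M * ‖k (v - u)‖) ?_ ?_ ?_ ?_
      · intro n
        refine AEStronglyMeasurable.mul ?_ hkv.aestronglyMeasurable.restrict
        exact Measurable.aestronglyMeasurable (by fun_prop)
      · exact (hkv.norm.const_mul M).integrableOn
      · intro n
        filter_upwards [ae_restrict_mem measurableSet_Ioi] with u hu
        rw [norm_mul, norm_mul, norm_exp]
        have h2 : (-(e n : ℂ) * (u : ℂ)).re = -(e n * u) := by simp
        rw [h2]
        have h3 : Real.exp (-(e n * u)) ≤ 1 :=
          Real.exp_le_one_iff.mpr (neg_nonpos.mpr (mul_nonneg (he0 n).le (le_of_lt hu)))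
        have h4 : ‖f u‖ * Real.exp (-(e n * u)) ≤ M * 1 :=
          mul_le_mul (hfM u) h3 (Real.exp_pos _).le ((norm_nonneg _).trans (hfM u))
        rw [mul_one] at h4
        gcongr
      · refine Eventually.of_forall fun u => ?_
        have h5 : Tendsto (fun n => exp (-(e n : ℂ) * u)) atTop (𝓝 1) := by
          have hc : Continuous fun x : ℝ => exp (-(x : ℂ) * u) := by fun_prop
          simpa [Function.comp_def] using (hc.tendsto 0).comp helim
        simpa using (h5.const_mul (f u)).mul_const (k (v - u))
    refine tendsto_nhds_unique hL (hR.congr fun n => ?_)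
    exact (hfub v (e n) (he0 n)).symm
  simp_rw [← hbd]
  have hRL := Real.tendsto_integral_exp_smul_cocompact fun t : ℝ => φ t * H (I * t)
  -- The Fourier character is exp(2πi·) and enters with a minus sign, so exp(itv) is frequency
  -- -v/(2π).
  have hw : Tendsto (fun v : ℝ => -v / (2 * Real.pi)) atTop (cocompact ℝ) := by
    refine Tendsto.mono_right ?_ atBot_le_cocompact
    exact (tendsto_neg_atTop_atBot).atBot_div_const (by positivity)
  refine (hRL.comp hw).congr fun v => ?_
  refine integral_congr_ae (Eventually.of_forall fun t => ?_)
  simp only [Circle.smul_def, Real.fourierChar_apply, smul_eq_mul]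
  rw [mul_comm]
  congr 2
  push_cast
  field_simp

/-! ### The Fejér kernel -/

/-- The Fourier transform of the triangle function is the Fejér kernel. -/
theorem integral_triangle_mul_exp (x : ℝ) :
    ∫ t : ℝ, ((max 0 (1 - |t|) : ℝ) : ℂ) * exp (I * t * x) = ((Real.sinc (x / 2) ^ 2 : ℝ) : ℂ) := by
  have hcont : Continuous fun t : ℝ => ((max 0 (1 - |t|) : ℝ) : ℂ) * exp (I * t * x) := by
    fun_prop
  have hsplit : ∫ t : ℝ, ((max 0 (1 - |t|) : ℝ) : ℂ) * exp (I * t * x) =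
      (∫ t in (-1 : ℝ)..0, (1 + t : ℂ) * exp (I * t * x)) +
        ∫ t in (0 : ℝ)..1, (1 - t : ℂ) * exp (I * t * x) := by
    have h1 : ∫ t in (-1 : ℝ)..0, (1 + t : ℂ) * exp (I * t * x) =
        ∫ t in (-1 : ℝ)..0, ((max 0 (1 - |t|) : ℝ) : ℂ) * exp (I * t * x) := by
      refine intervalIntegral.integral_congr fun t ht => ?_
      rw [Set.uIcc_of_le (by norm_num)] at ht
      rw [abs_of_nonpos ht.2, max_eq_right (by linarith [ht.1])]
      push_cast; ring
    have h2 : ∫ t in (0 : ℝ)..1, (1 - t : ℂ) * exp (I * t * x) =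
        ∫ t in (0 : ℝ)..1, ((max 0 (1 - |t|) : ℝ) : ℂ) * exp (I * t * x) := by
      refine intervalIntegral.integral_congr fun t ht => ?_
      rw [Set.uIcc_of_le (by norm_num)] at ht
      rw [abs_of_nonneg ht.1, max_eq_right (by linarith [ht.2])]
      push_cast; ring
    rw [h1, h2, intervalIntegral.integral_add_adjacent_intervals (hcont.intervalIntegrable _ _)
      (hcont.intervalIntegrable _ _), intervalIntegral.integral_of_le (by norm_num)]
    refine (setIntegral_eq_integral_of_forall_compl_eq_zero fun t ht => ?_).symm
    rw [max_eq_left]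
    · simp
    · by_contra hlt
      have := abs_lt.mp (show |t| < 1 by linarith)
      exact ht ⟨this.1, this.2.le⟩
  rw [hsplit]
  rcases eq_or_ne x 0 with rfl | hx
  · have h1 : ∀ t : ℝ, HasDerivAt (fun t : ℝ => (t + t ^ 2 / 2 : ℂ)) (1 + t : ℂ) t := by
      intro t
      have := ((hasDerivAt_id (t : ℂ)).add (((hasDerivAt_id (t : ℂ)).pow 2).div_const 2)).comp_ofReal
      exact this.congr_deriv (by simp)
    have h2 : ∀ t : ℝ, HasDerivAt (fun t : ℝ => (t - t ^ 2 / 2 : ℂ)) (1 - t : ℂ) t := by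
      intro t
      have := ((hasDerivAt_id (t : ℂ)).sub (((hasDerivAt_id (t : ℂ)).pow 2).div_const 2)).comp_ofReal
      exact this.congr_deriv (by simp)
    simp only [ofReal_zero, mul_zero, exp_zero, mul_one, zero_div, Real.sinc_zero]
    rw [intervalIntegral.integral_eq_sub_of_hasDerivAt (fun t _ => h1 t)
        (Continuous.intervalIntegrable (by fun_prop) _ _),
      intervalIntegral.integral_eq_sub_of_hasDerivAt (fun t _ => h2 t)
        (Continuous.intervalIntegrable (by fun_prop) _ _)]
    norm_num
  · have hxC : (x : ℂ) ≠ 0 := ofReal_ne_zero.mpr hx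
    have ha : I * (x : ℂ) ≠ 0 := mul_ne_zero I_ne_zero hxC
    have hE : ∀ t : ℂ, HasDerivAt (fun t : ℂ => exp (I * t * x)) (exp (I * t * x) * (I * x)) t := by
      intro t
      have := (((hasDerivAt_id t).const_mul I).mul_const (x : ℂ)).cexp
      simpa using this
    -- Antiderivatives found by integrating by parts; they need x ≠ 0.
    have h1 : ∀ t : ℝ, HasDerivAt (fun t : ℝ => ((1 + t : ℂ) * exp (I * t * x) / (I * x) -
        exp (I * t * x) / (I * x) ^ 2)) ((1 + t : ℂ) * exp (I * t * x)) t := by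
      intro t
      have := (((((hasDerivAt_id (t : ℂ)).const_add 1).mul (hE t)).div_const (I * x)).sub
        ((hE t).div_const ((I * x) ^ 2))).comp_ofReal
      refine this.congr_deriv ?_
      simp only [id]
      field_simp
      ring
    have h2 : ∀ t : ℝ, HasDerivAt (fun t : ℝ => ((1 - t : ℂ) * exp (I * t * x) / (I * x) +
        exp (I * t * x) / (I * x) ^ 2)) ((1 - t : ℂ) * exp (I * t * x)) t := by
      intro t
      have := (((((hasDerivAt_id (t : ℂ)).const_sub 1).mul (hE t)).div_const (I * x)).add
        ((hE t).div_const ((I * x) ^ 2))).comp_ofReal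
      refine this.congr_deriv ?_
      simp only [id]
      field_simp
      ring
    rw [intervalIntegral.integral_eq_sub_of_hasDerivAt (fun t _ => h1 t)
        (Continuous.intervalIntegrable (by fun_prop) _ _),
      intervalIntegral.integral_eq_sub_of_hasDerivAt (fun t _ => h2 t)
        (Continuous.intervalIntegrable (by fun_prop) _ _),
      Real.sinc_of_ne_zero (by positivity)]
    have hs : Real.sin (x / 2) ^ 2 = 1 / 2 - Real.cos x / 2 := by
      rw [Real.sin_sq_eq_half_sub]; congr 3; ring
    rw [div_pow, hs]
    push_cast
    have hcos : Complex.cos x = (exp (I * x) + exp (-(I * x))) / 2 := by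
      rw [Complex.cos]; ring_nf
    rw [hcos]
    simp only [mul_one, mul_zero, zero_mul, exp_zero, mul_neg, neg_mul, add_neg_cancel, sub_self,
      zero_div, zero_sub, zero_add, sub_zero, add_zero]
    rw [mul_pow, I_sq]
    field_simp
    ring

theorem sinc_half_sq_le (x : ℝ) : Real.sinc (x / 2) ^ 2 ≤ 8 * (1 + x ^ 2)⁻¹ := by
  rw [← div_eq_mul_inv, le_div_iff₀ (by positivity)]
  have h1 : Real.sinc (x / 2) ^ 2 ≤ 1 := by
    rw [sq_le_one_iff_abs_le_one]; exact Real.abs_sinc_le_one _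
  have h2 : Real.sinc (x / 2) ^ 2 * x ^ 2 ≤ 4 := by
    rcases eq_or_ne x 0 with rfl | hx
    · simp
    · rw [Real.sinc_of_ne_zero (by positivity), div_pow]
      have : Real.sin (x / 2) ^ 2 / (x / 2) ^ 2 * x ^ 2 = 4 * Real.sin (x / 2) ^ 2 := by
        field_simp; ring
      rw [this]
      linarith [Real.sin_sq_le_one (x / 2)]
  linarith

theorem integrable_sinc_half_sq : Integrable fun x : ℝ => Real.sinc (x / 2) ^ 2 := by
  refine (integrable_inv_one_add_sq.const_mul 8).mono' ?_ (Eventually.of_forall fun x => ?_)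
  · have := Real.continuous_sinc
    exact Continuous.aestronglyMeasurable (by fun_prop)
  · rw [Real.norm_of_nonneg (by positivity)]
    exact sinc_half_sq_le x

theorem integral_sinc_half_sq_pos : 0 < ∫ x : ℝ, Real.sinc (x / 2) ^ 2 := by
  have := Real.continuous_sinc
  refine integral_pos_of_integrable_nonneg_nonzero (x := 0) (by fun_prop) integrable_sinc_half_sq
    (fun x => by positivity) (by simp)

/-- Nonnegative kernels with compactly supported spectrum and mass concentrated near the origin. -/
theorem exists_concentrated_kernel {δ : ℝ} (hδ : 0 < δ) :
    ∃ (φ : ℝ → ℂ) (k : ℝ → ℝ), Continuous φ ∧ HasCompactSupport φ ∧ (∀ x, 0 ≤ k x) ∧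
      Integrable k ∧ (∀ x : ℝ, ∫ t : ℝ, φ t * exp (I * t * x) = k x) ∧ 0 < ∫ x, k x ∧
      (1 - δ) * ∫ x, k x ≤ ∫ x in Set.Icc (-δ) δ, k x := by
  set K : ℝ → ℝ := fun x => Real.sinc (x / 2) ^ 2 with hK
  have hc : 0 < ∫ x, K x := integral_sinc_half_sq_pos
  have hlim : Tendsto (fun R : ℝ => ∫ x in -R..R, K x) atTop (𝓝 (∫ x, K x)) :=
    intervalIntegral_tendsto_integral integrable_sinc_half_sq tendsto_neg_atTop_atBot tendsto_id
  obtain ⟨R, hR, hR0⟩ := ((hlim.eventually_const_le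
    (show (1 - δ) * ∫ x, K x < ∫ x, K x by nlinarith)).and
      (eventually_gt_atTop 0)).exists
  -- Rescaling by l squeezes the mass on [-R, R] into [-δ, δ].
  set l : ℝ := R / δ with hl
  have hl0 : 0 < l := by positivity
  have hmass : ∫ x, l * K (l * x) = ∫ x, K x := by
    rw [integral_const_mul, Measure.integral_comp_mul_left, abs_of_pos (inv_pos.mpr hl0), smul_eq_mul]
    field_simp
  refine ⟨fun t => ((max 0 (1 - |l⁻¹ * t|) : ℝ) : ℂ), fun x => l * K (l * x), by fun_prop, ?_,
    fun x => by positivity, ?_, fun x => ?_, ?_, ?_⟩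
  · refine HasCompactSupport.of_support_subset_isCompact (isCompact_Icc (a := -l) (b := l)) ?_
    intro t ht
    rw [Function.mem_support] at ht
    by_contra hnot
    apply ht
    rw [max_eq_left, ofReal_zero]
    by_contra hlt
    rw [abs_mul, abs_of_pos (inv_pos.mpr hl0)] at hlt
    have h1 : l⁻¹ * |t| < 1 := by linarith
    rw [inv_mul_lt_iff₀ hl0, mul_one] at h1
    exact hnot ⟨(abs_lt.mp h1).1.le, (abs_lt.mp h1).2.le⟩
  · exact ((integrable_comp_mul_left_iff K hl0.ne').mpr integrable_sinc_half_sq).const_mul l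
  · have h := Measure.integral_comp_mul_left
      (fun t : ℝ => ((max 0 (1 - |t|) : ℝ) : ℂ) * exp (I * t * (l * x : ℝ))) l⁻¹
    rw [integral_triangle_mul_exp, inv_inv, abs_of_pos hl0, real_smul] at h
    rw [hK]
    push_cast at h ⊢
    rw [← h]
    refine integral_congr_ae (Eventually.of_forall fun t => ?_)
    simp only
    congr 2
    have : (l : ℂ) ≠ 0 := ofReal_ne_zero.mpr hl0.ne'
    field_simp
  · rw [hmass]; exact hc
  · rw [hmass, integral_Icc_eq_integral_Ioc, ← intervalIntegral.integral_of_le (by linarith),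
      intervalIntegral.integral_const_mul, intervalIntegral.mul_integral_comp_mul_left]
    have : l * δ = R := by rw [hl]; field_simp
    rw [mul_neg, this]
    exact hR

/-! ### The Tauberian theorem -/

/-- Averages of `g` against a concentrated kernel tend to the total mass of the kernel. -/
theorem tendsto_integral_comp_sub_mul_kernel {g : ℝ → ℝ} (hgm : Measurable g)
    (hg0 : ∀ u ≤ 0, g u = 0) {M : ℝ} (hgM : ∀ u, |g u| ≤ M)
    {H : ℂ → ℂ} (hH : ContinuousOn H {z | 0 ≤ z.re})
    (hgH : ∀ z : ℂ, 0 < z.re → ∫ u in Set.Ioi (0 : ℝ), ((g u : ℂ) - 1) * exp (-z * u) = H z)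
    {φ : ℝ → ℂ} (hφ : Continuous φ) (hφc : HasCompactSupport φ)
    {k : ℝ → ℝ} (hk : Integrable k) (hkφ : ∀ x : ℝ, ∫ t : ℝ, φ t * exp (I * t * x) = k x) :
    Tendsto (fun v : ℝ => ∫ x, g (v - x) * k x) atTop (𝓝 (∫ x, k x)) := by
  have hlim := tendsto_setIntegral_mul_kernel_of_laplace_continuousOn
    (f := fun u => (g u : ℂ) - 1) (by fun_prop) (M := M + 1)
    (fun u => (norm_sub_le _ _).trans (by
      rw [norm_real, norm_one, Real.norm_eq_abs]; linarith [hgM u])) hH hgH hφ hφc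
    (k := fun x => (k x : ℂ)) hk.ofReal hkφ
  have hlim' : Tendsto (fun v : ℝ => ∫ u in Set.Ioi (0 : ℝ), (g u - 1) * k (v - u)) atTop
      (𝓝 0) := by
    have h := (continuous_re.tendsto 0).comp hlim
    rw [zero_re] at h
    refine h.congr fun v => ?_
    have : ∀ u, ((g u : ℂ) - 1) * (k (v - u) : ℂ) = (((g u - 1) * k (v - u) : ℝ) : ℂ) := by
      intro u; push_cast; ring
    simp only [Function.comp_apply, this]
    rw [integral_complex_ofReal, ofReal_re]
  -- The subtracted constant 1 on (0, ∞) contributes the kernel mass on (-∞, v), which tends to the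
  -- full mass.
  have hone : Tendsto (fun v : ℝ => ∫ x in Set.Iio v, k x) atTop (𝓝 (∫ x, k x)) :=
    (aecover_Iio (tendsto_id (α := ℝ))).integral_tendsto_of_countably_generated hk
  have hsum := hlim'.add hone
  rw [zero_add] at hsum
  refine hsum.congr fun v => ?_
  have hkv : Integrable fun u => k (v - u) := hk.comp_sub_left v
  have hgk : Integrable fun u => g u * k (v - u) :=
    hkv.bdd_mul (c := M) hgm.aestronglyMeasurable (Eventually.of_forall fun u => hgM u)
  have h1 : ∫ x in Set.Iio v, k x = ∫ u in Set.Ioi (0 : ℝ), k (v - u) := by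
    rw [← integral_indicator measurableSet_Iio, ← integral_indicator measurableSet_Ioi,
      ← integral_sub_left_eq_self _ _ v]
    refine integral_congr_ae (Eventually.of_forall fun u => ?_)
    by_cases hu : 0 < u <;> simp [Set.indicator, hu]
  have h2 : ∫ x, g (v - x) * k x = ∫ u in Set.Ioi (0 : ℝ), g u * k (v - u) := by
    rw [setIntegral_eq_integral_of_forall_compl_eq_zero
      (fun u hu => by rw [hg0 u (not_lt.mp hu), zero_mul]),
      ← integral_sub_left_eq_self (fun u => g u * k (v - u)) _ v]
    simp
  rw [h1, h2, ← integral_add _ hkv.integrableOn]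
  · refine integral_congr_ae (Eventually.of_forall fun u => ?_)
    simp only
    ring
  · simp only [sub_mul, one_mul]
    exact (hgk.sub hkv).integrableOn

/-- A Wiener–Ikehara theorem in additive form, for bounded `g` with `g u * exp u` increasing. -/
theorem tendsto_one_of_laplace_continuousOn {g : ℝ → ℝ}
    (hgmono : Monotone fun u => g u * Real.exp u)
    (hg0 : ∀ u ≤ 0, g u = 0) (hgnn : ∀ u, 0 ≤ g u) {M : ℝ} (hgM : ∀ u, g u ≤ M)
    {H : ℂ → ℂ} (hH : ContinuousOn H {z | 0 ≤ z.re})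
    (hgH : ∀ z : ℂ, 0 < z.re → ∫ u in Set.Ioi (0 : ℝ), ((g u : ℂ) - 1) * exp (-z * u) = H z) :
    Tendsto g atTop (𝓝 1) := by
  have hgm : Measurable g := by
    have h : g = fun u => g u * Real.exp u * Real.exp (-u) := by
      funext u; rw [mul_assoc, ← Real.exp_add]; simp
    rw [h]
    exact hgmono.measurable.mul (by fun_prop)
  have hM0 : 0 ≤ M := (hgnn 0).trans (hgM 0)
  have hslow : ∀ a b : ℝ, a ≤ b → g a * Real.exp (a - b) ≤ g b := by
    intro a b hab
    have h := hgmono hab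
    simp only at h
    rw [Real.exp_sub, ← mul_div_assoc, div_le_iff₀ (Real.exp_pos b)]
    exact h
  have key : ∀ δ : ℝ, 0 < δ → δ < 1 → ∀ᶠ v in atTop,
      g v ≤ Real.exp (2 * δ) * ((1 + δ) / (1 - δ)) ∧
        Real.exp (-(2 * δ)) * (1 - δ - M * δ) ≤ g v := by
    intro δ hδ hδ1
    obtain ⟨φ, k, hφ, hφc, hknn, hk, hkφ, hc, hcon⟩ := exists_concentrated_kernel hδ
    have hT := tendsto_integral_comp_sub_mul_kernel hgm hg0
      (fun u => by rw [abs_of_nonneg (hgnn u)]; exact hgM u) hH hgH hφ hφc hk hkφ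
    set c : ℝ := ∫ x, k x with hcdef
    have hup := hT.eventually_le_const (show c < (1 + δ) * c by nlinarith)
    have hlo := hT.eventually_const_le (show (1 - δ) * c < c by nlinarith)
    have hint : ∀ v, Integrable fun x => g (v - x) * k x := fun v =>
      hk.bdd_mul (c := M) (hgm.comp (by fun_prop)).aestronglyMeasurable
        (Eventually.of_forall fun x => by
          rw [Real.norm_of_nonneg (hgnn _)]; exact hgM _)
    -- Centring at v + δ puts v + δ - x in [v, v + 2δ] for |x| ≤ δ, where g is at least g(v)
    -- e^{-2δ}.
    have hU : ∀ v, g v * Real.exp (-(2 * δ)) * ((1 - δ) * c) ≤ ∫ x, g (v + δ - x) * k x := by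
      intro v
      calc g v * Real.exp (-(2 * δ)) * ((1 - δ) * c)
          ≤ g v * Real.exp (-(2 * δ)) * ∫ x in Set.Icc (-δ) δ, k x :=
            mul_le_mul_of_nonneg_left hcon (mul_nonneg (hgnn v) (Real.exp_pos _).le)
        _ = ∫ x in Set.Icc (-δ) δ, g v * Real.exp (-(2 * δ)) * k x := (integral_const_mul _ _).symm
        _ ≤ ∫ x in Set.Icc (-δ) δ, g (v + δ - x) * k x := by
            refine setIntegral_mono_on (hk.integrableOn.const_mul _) (hint _).integrableOn
              measurableSet_Icc fun x hx => ?_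
            refine mul_le_mul_of_nonneg_right ?_ (hknn x)
            refine le_trans ?_ (hslow v (v + δ - x) (by linarith [hx.2]))
            refine mul_le_mul_of_nonneg_left (Real.exp_le_exp.mpr ?_) (hgnn v)
            linarith [hx.1]
        _ ≤ ∫ x, g (v + δ - x) * k x :=
            setIntegral_le_integral (hint _)
              (Eventually.of_forall fun x => mul_nonneg (hgnn _) (hknn x))
    -- Centring at v - δ gives points of [v - 2δ, v], where g is at most g(v) e^{2δ}; outside [-δ,
    -- δ] the kernel has mass at most δc and g ≤ M.
    have hL : ∀ v, ∫ x, g (v - δ - x) * k x ≤ g v * Real.exp (2 * δ) * c + M * (δ * c) := by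
      intro v
      rw [← integral_add_compl (measurableSet_Icc (a := -δ) (b := δ)) (hint _)]
      have hcompl : ∫ x in (Set.Icc (-δ) δ)ᶜ, k x ≤ δ * c := by
        have := integral_add_compl (measurableSet_Icc (a := -δ) (b := δ)) hk
        linarith
      refine add_le_add ?_ ?_
      · calc ∫ x in Set.Icc (-δ) δ, g (v - δ - x) * k x
            ≤ ∫ x in Set.Icc (-δ) δ, g v * Real.exp (2 * δ) * k x := by
              refine setIntegral_mono_on (hint _).integrableOn (hk.integrableOn.const_mul _)
                measurableSet_Icc fun x hx => ?_
              refine mul_le_mul_of_nonneg_right ?_ (hknn x)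
              have h1 := hslow (v - δ - x) v (by linarith [hx.1])
              have h2 : g (v - δ - x) * Real.exp (-(2 * δ)) ≤ g v := by
                refine le_trans ?_ h1
                refine mul_le_mul_of_nonneg_left (Real.exp_le_exp.mpr ?_) (hgnn _)
                linarith [hx.2]
              rwa [Real.exp_neg, ← div_eq_mul_inv, div_le_iff₀ (Real.exp_pos _)] at h2
          _ = g v * Real.exp (2 * δ) * ∫ x in Set.Icc (-δ) δ, k x := integral_const_mul _ _
          _ ≤ g v * Real.exp (2 * δ) * c := by
              refine mul_le_mul_of_nonneg_left ?_ (mul_nonneg (hgnn v) (Real.exp_pos _).le)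
              exact setIntegral_le_integral hk (Eventually.of_forall hknn)
      · calc ∫ x in (Set.Icc (-δ) δ)ᶜ, g (v - δ - x) * k x
            ≤ ∫ x in (Set.Icc (-δ) δ)ᶜ, M * k x := by
              refine setIntegral_mono (hint _).integrableOn (hk.integrableOn.const_mul _)
                fun x => mul_le_mul_of_nonneg_right (hgM _) (hknn x)
          _ = M * ∫ x in (Set.Icc (-δ) δ)ᶜ, k x := integral_const_mul _ _
          _ ≤ M * (δ * c) := mul_le_mul_of_nonneg_left hcompl hM0
    filter_upwards [(tendsto_atTop_add_const_right _ δ tendsto_id).eventually hup,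
      (tendsto_atTop_add_const_right _ (-δ) tendsto_id).eventually hlo] with v hv1 hv2
    simp only [id] at hv1 hv2
    have hE : 0 < Real.exp (2 * δ) := Real.exp_pos _
    constructor
    · have h := (hU v).trans hv1
      rw [← mul_assoc] at h
      have h' := le_of_mul_le_mul_right h hc
      rw [Real.exp_neg, ← div_eq_mul_inv, div_mul_eq_mul_div, div_le_iff₀ hE] at h'
      rw [← mul_div_assoc, le_div_iff₀ (by linarith)]
      linarith
    · have h := hv2.trans (hL v)
      have h' : (1 - δ - M * δ) * c ≤ g v * Real.exp (2 * δ) * c := by linarith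
      have h'' := le_of_mul_le_mul_right h' hc
      rw [Real.exp_neg, inv_mul_le_iff₀ hE]
      linarith
  have hup1 : Tendsto (fun δ : ℝ => Real.exp (2 * δ) * ((1 + δ) / (1 - δ))) (𝓝[>] 0) (𝓝 1) := by
    have : ContinuousAt (fun δ : ℝ => Real.exp (2 * δ) * ((1 + δ) / (1 - δ))) 0 :=
      ContinuousAt.mul (by fun_prop) (ContinuousAt.div (by fun_prop) (by fun_prop) (by norm_num))
    simpa [ContinuousAt] using this.tendsto.mono_left nhdsWithin_le_nhds
  have hlo1 : Tendsto (fun δ : ℝ => Real.exp (-(2 * δ)) * (1 - δ - M * δ)) (𝓝[>] 0) (𝓝 1) := by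
    have : Continuous (fun δ : ℝ => Real.exp (-(2 * δ)) * (1 - δ - M * δ)) := by fun_prop
    simpa using (this.tendsto 0).mono_left (nhdsWithin_le_nhds (s := Set.Ioi 0))
  have hsmall : ∀ᶠ δ : ℝ in 𝓝[>] 0, 0 < δ ∧ δ < 1 :=
    Ioo_mem_nhdsGT zero_lt_one
  refine tendsto_order.mpr ⟨fun a ha => ?_, fun a ha => ?_⟩
  · obtain ⟨δ, h, hδ, hδ1⟩ := ((hlo1.eventually_const_lt ha).and hsmall).exists
    filter_upwards [key δ hδ hδ1] with v hv using h.trans_le hv.2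
  · obtain ⟨δ, h, hδ, hδ1⟩ := ((hup1.eventually_lt_const ha).and hsmall).exists
    filter_upwards [key δ hδ hδ1] with v hv using hv.1.trans_lt h

/-! ### The prime number theorem -/

/-- Laplace transform of `ψ (exp u) / exp u - 1`. -/
theorem integral_psi_exp_sub_one_mul_exp {z : ℂ} (hz : 0 < z.re) :
    ∫ u in Set.Ioi (0 : ℝ), (((Chebyshev.psi (Real.exp u) * Real.exp (-u) : ℝ) : ℂ) - 1) *
        exp (-z * u) =
      (ArithmeticFunction.vonMangoldt.LFunctionResidueClassAux (1 : ZMod 1) (1 + z) - 1) /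
        (1 + z) := by
  have hs : 1 < (1 + z).re := by simpa using hz
  have hs0 : 1 + z ≠ 0 := fun h => by rw [h] at hs; simp at hs; linarith
  have hz0 : z ≠ 0 := fun h => by simp [h] at hz
  -- Modulo 1 there is a single residue class, so the Dirichlet machinery specialises to ζ.
  have hres : ∀ n : ℕ, ArithmeticFunction.vonMangoldt.residueClass (1 : ZMod 1) n =
      ArithmeticFunction.vonMangoldt n := by
    intro n
    simp [ArithmeticFunction.vonMangoldt.residueClass, Set.indicator, Subsingleton.elim _ (1 : ZMod 1)]
  have hpsi : ∀ t : ℝ, ∑ n ∈ Finset.Icc 1 ⌊t⌋₊,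
      ArithmeticFunction.vonMangoldt.residueClass (1 : ZMod 1) n = Chebyshev.psi t := by
    intro t
    simp_rw [hres, Chebyshev.psi]
    rfl
  have hO : (fun n : ℕ => ∑ m ∈ Finset.Icc 1 n,
      ArithmeticFunction.vonMangoldt.residueClass (1 : ZMod 1) m) =O[atTop]
        fun n => (n : ℝ) ^ (1 : ℝ) := by
    refine Asymptotics.IsBigO.of_bound (Real.log 4 + 4) (Eventually.of_forall fun n => ?_)
    have h := hpsi n
    rw [Nat.floor_natCast] at h
    rw [h, Real.rpow_one, Real.norm_of_nonneg (Chebyshev.psi_nonneg _),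
      Real.norm_of_nonneg (Nat.cast_nonneg n)]
    exact Chebyshev.psi_le_const_mul_self (Nat.cast_nonneg n)
  have hF := ArithmeticFunction.vonMangoldt.eqOn_LFunctionResidueClassAux
    (q := 1) (a := 1) isUnit_one (x := 1 + z) hs
  have hL := LSeries_eq_mul_integral_of_nonneg _ zero_le_one hs hO
    (ArithmeticFunction.vonMangoldt.residueClass_nonneg (1 : ZMod 1))
  have hint : ∫ t in Set.Ioi (1 : ℝ), (∑ n ∈ Finset.Icc 1 ⌊t⌋₊,
        (ArithmeticFunction.vonMangoldt.residueClass (1 : ZMod 1) n : ℂ)) * (t : ℂ) ^ (-(1 + z + 1)) =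
      ∫ u in Set.Ioi (0 : ℝ), ((Chebyshev.psi (Real.exp u) * Real.exp (-u) : ℝ) : ℂ) *
        exp (-z * u) := by
    -- Substitution t = e^u.
    rw [← Real.exp_zero, ← integral_comp_exp_Ioi]
    refine integral_congr_ae (Eventually.of_forall fun u => ?_)
    simp only
    rw [← ofReal_sum, hpsi, real_smul, cpow_def_of_ne_zero (by simp), ← ofReal_log (Real.exp_pos u).le,
      Real.log_exp]
    push_cast
    have : exp (u : ℂ) * exp (u * -(1 + z + 1)) = exp (-u) * exp (-z * u) := by
      rw [← exp_add, ← exp_add]; congr 1; ring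
    linear_combination (Chebyshev.psi (Real.exp u) : ℂ) * this
  have hexp : IntegrableOn (fun u : ℝ => exp (-z * u)) (Set.Ioi 0) :=
    integrableOn_exp_mul_complex_Ioi (by simpa using hz) 0
  have hexpval : ∫ u in Set.Ioi (0 : ℝ), exp (-z * u) = 1 / z := by
    rw [integral_exp_mul_complex_Ioi (by simpa using hz)]
    simp
  have hgi : IntegrableOn (fun u : ℝ => ((Chebyshev.psi (Real.exp u) * Real.exp (-u) : ℝ) : ℂ) *
      exp (-z * u)) (Set.Ioi 0) := by
    refine Integrable.bdd_mul (c := Real.log 4 + 4) hexp ?_ (Eventually.of_forall fun u => ?_)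
    · have := Chebyshev.psi_mono.measurable
      exact Measurable.aestronglyMeasurable (by fun_prop)
    · rw [norm_real, Real.norm_of_nonneg (mul_nonneg (Chebyshev.psi_nonneg _) (Real.exp_pos _).le),
        Real.exp_neg, ← div_eq_mul_inv, div_le_iff₀ (Real.exp_pos u)]
      exact Chebyshev.psi_le_const_mul_self (Real.exp_pos u).le
  simp only [sub_mul, one_mul]
  rw [integral_sub hgi hexp, hexpval, ← hint, hF]
  simp only
  rw [hL]
  simp only [Nat.totient_one, Nat.cast_one, inv_one, add_sub_cancel_left]
  field_simp
  ring

/-- The prime number theorem for the Chebyshev function `ψ`. -/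
theorem tendsto_psi_div_self : Tendsto (fun x => Chebyshev.psi x / x) atTop (𝓝 1) := by
  have hH : ContinuousOn (fun z : ℂ =>
      (ArithmeticFunction.vonMangoldt.LFunctionResidueClassAux (1 : ZMod 1) (1 + z) - 1) /
        (1 + z)) {z | 0 ≤ z.re} := by
    refine ContinuousOn.div (ContinuousOn.sub ?_ continuousOn_const) (by fun_prop) ?_
    · refine (ArithmeticFunction.vonMangoldt.continuousOn_LFunctionResidueClassAux
        (1 : ZMod 1)).comp (by fun_prop) fun z hz => ?_
      simpa using hz
    · intro z hz h
      have := congrArg re h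
      simp only [add_re, one_re, zero_re] at this
      have hz' : 0 ≤ z.re := hz
      linarith
  have h := tendsto_one_of_laplace_continuousOn
    (g := fun u => Chebyshev.psi (Real.exp u) * Real.exp (-u)) (M := Real.log 4 + 4)
    (fun a b hab => by
      simp only [mul_assoc, ← Real.exp_add, neg_add_cancel, Real.exp_zero, mul_one]
      exact Chebyshev.psi_mono (Real.exp_le_exp.mpr hab))
    (fun u hu => by
      rw [Chebyshev.psi_eq_zero_of_le_one (Real.exp_le_one_iff.mpr hu), zero_mul])
    (fun u => mul_nonneg (Chebyshev.psi_nonneg _) (Real.exp_pos _).le)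
    (fun u => by
      rw [Real.exp_neg, ← div_eq_mul_inv, div_le_iff₀ (Real.exp_pos u)]
      exact Chebyshev.psi_le_const_mul_self (Real.exp_pos u).le)
    hH (fun z hz => integral_psi_exp_sub_one_mul_exp hz)
  refine (h.comp Real.tendsto_log_atTop).congr' ?_
  filter_upwards [eventually_gt_atTop 0] with x hx
  simp [Real.exp_neg, Real.exp_log hx, div_eq_mul_inv]

/-- The prime number theorem for the Chebyshev function `θ`. -/
theorem tendsto_theta_div_self : Tendsto (fun x => Chebyshev.theta x / x) atTop (𝓝 1) := by
  have h : (Chebyshev.psi - Chebyshev.theta) =o[atTop] fun x : ℝ => x := by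
    refine Chebyshev.isBigO_psi_sub_theta_sqrt.trans_isLittleO ?_
    refine isLittleO_of_tendsto (fun x hx => by simp [hx]) ?_
    refine (Real.tendsto_sqrt_atTop.inv_tendsto_atTop).congr fun x => ?_
    rw [Real.sqrt_div_self', one_div, Pi.inv_apply]
  have h' := tendsto_psi_div_self.sub h.tendsto_div_nhds_zero
  rw [sub_zero] at h'
  refine h'.congr fun x => ?_
  simp only [Pi.sub_apply]
  ring

/-- The prime number theorem. -/
theorem tendsto_primeCounting_mul_log_div_self :
    Tendsto (fun x : ℝ => (Nat.primeCounting ⌊x⌋₊ : ℝ) * Real.log x / x) atTop (𝓝 1) := by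
  have h1 : (fun x : ℝ => ((Nat.primeCounting ⌊x⌋₊ : ℝ) - Chebyshev.theta x / Real.log x) *
      (Real.log x / x)) =O[atTop] fun x => (Real.log x)⁻¹ := by
    refine (Chebyshev.primeCounting_sub_theta_div_log_isBigO.mul
      (isBigO_refl (fun x : ℝ => Real.log x / x) atTop)).congr' EventuallyEq.rfl ?_
    filter_upwards [eventually_gt_atTop 1] with x hx
    have := Real.log_pos hx
    field_simp
  have h2 := (h1.trans_tendsto Real.tendsto_log_atTop.inv_tendsto_atTop).add
    tendsto_theta_div_self
  rw [zero_add] at h2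
  refine h2.congr' ?_
  filter_upwards [eventually_gt_atTop 1] with x hx
  have := Real.log_pos hx
  field_simp
  ring

/-! ### Asymptotics of the n-th prime -/

theorem primeCounting_nthPrime {n : ℕ} (hn : 1 ≤ n) : Nat.primeCounting (nthPrime n) = n := by
  rw [nthPrime, Nat.primeCounting, Nat.primeCounting',
    Nat.count_nth_succ_of_infinite Nat.infinite_setOfPred_prime]
  omega

theorem le_nthPrime (n : ℕ) : n ≤ nthPrime n := by
  have := Nat.add_two_le_nth_prime (n - 1)
  rw [nthPrime]
  omega

theorem tendsto_nthPrime_atTop : Tendsto (fun n : ℕ => (nthPrime n : ℝ)) atTop atTop :=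
  tendsto_atTop_mono (fun n => Nat.cast_le.mpr (le_nthPrime n)) tendsto_natCast_atTop_atTop

/-- The `n`-th prime is asymptotic to `n log n`. -/
theorem nthPrime_isEquivalent :
    (fun n : ℕ => (nthPrime n : ℝ)) ~[atTop] fun n : ℕ => (n : ℝ) * Real.log n := by
  have hp := tendsto_nthPrime_atTop
  have hlogp : Tendsto (fun n : ℕ => Real.log (nthPrime n)) atTop atTop :=
    Real.tendsto_log_atTop.comp hp
  have hp0 : ∀ᶠ n : ℕ in atTop, (1 : ℝ) < nthPrime n := hp.eventually_gt_atTop 1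
  have h1 : Tendsto (fun n : ℕ => (n : ℝ) * Real.log (nthPrime n) / nthPrime n) atTop (𝓝 1) := by
    refine (tendsto_primeCounting_mul_log_div_self.comp hp).congr' ?_
    filter_upwards [eventually_ge_atTop 1] with n hn
    simp [primeCounting_nthPrime hn]
  have h2 : (fun n : ℕ => (n : ℝ)) ~[atTop] fun n : ℕ => nthPrime n / Real.log (nthPrime n) := by
    refine (isEquivalent_iff_tendsto_one ?_).mpr (h1.congr fun n => ?_)
    · filter_upwards [hp0] with n hn
      exact div_ne_zero (by linarith) (Real.log_pos hn).ne'
    · simp [div_div_eq_mul_div]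
  have hll : Tendsto (fun n : ℕ => Real.log (Real.log (nthPrime n)) / Real.log (nthPrime n)) atTop
      (𝓝 0) :=
    Real.isLittleO_log_id_atTop.tendsto_div_nhds_zero.comp hlogp
  -- Taking logarithms in n ~ p_n / log p_n leaves log p_n - log log p_n, whose second term is
  -- negligible.
  have h3 : (fun n : ℕ => Real.log n) ~[atTop] fun n : ℕ => Real.log (nthPrime n) := by
    refine (h2.log (h2.tendsto_atTop tendsto_natCast_atTop_atTop)).trans ?_
    refine (isEquivalent_iff_tendsto_one ?_).mpr ?_
    · filter_upwards [hp0] with n hn using (Real.log_pos hn).ne'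
    · have h := hll.const_sub 1
      rw [sub_zero] at h
      refine h.congr' ?_
      filter_upwards [hp0] with n hn
      have hlog := Real.log_pos hn
      simp only [Pi.div_apply]
      rw [Real.log_div (by linarith) hlog.ne', sub_div, div_self hlog.ne']
  refine (h2.mul h3).symm.congr_left ?_
  filter_upwards [hp0] with n hn
  have hlog := Real.log_pos hn
  simp only [Pi.mul_apply]
  field_simp

/-! ### The sum of the first n primes -/

theorem natCast_isLittleO_mul_log :
    (fun n : ℕ => (n : ℝ)) =o[atTop] fun n : ℕ => (n : ℝ) * Real.log n := by
  have h : (fun _ : ℕ => (1 : ℝ)) =o[atTop] fun n : ℕ => Real.log n :=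
    (isLittleO_one_left_iff ℝ).mpr (tendsto_norm_atTop_atTop.comp
      (Real.tendsto_log_atTop.comp tendsto_natCast_atTop_atTop))
  simpa using (isBigO_refl (fun n : ℕ => (n : ℝ)) atTop).mul_isLittleO h

/-- The increments of `m ^ 2 log m / 2` compared with `m log m`. -/
theorem sq_mul_log_increment_bounds {m : ℝ} (hm : 1 ≤ m) :
    m * Real.log m ≤ 2 * (m ^ 2 * Real.log m / 2 - (m - 1) ^ 2 * Real.log (m - 1) / 2) ∧
      |m * Real.log m - (m ^ 2 * Real.log m / 2 - (m - 1) ^ 2 * Real.log (m - 1) / 2)| ≤ m := by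
  have hl0 : 0 ≤ Real.log m := Real.log_nonneg hm
  have hl1 : Real.log m ≤ m := (Real.log_le_self (by linarith))
  -- With d denoting this quantity, the increment equals (m - 1/2) log m + d/2, so 0 ≤ d ≤ m gives
  -- both claims. At m = 1 the factor (m - 1)² makes the value of log 0 irrelevant.
  obtain ⟨hd0, hd1⟩ : 0 ≤ (m - 1) ^ 2 * (Real.log m - Real.log (m - 1)) ∧
      (m - 1) ^ 2 * (Real.log m - Real.log (m - 1)) ≤ m := by
    rcases hm.eq_or_lt with rfl | hm1
    · simp
    · have hpos : 0 < m - 1 := by linarith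
      have h1 : Real.log (m - 1) ≤ Real.log m := Real.log_le_log hpos (by linarith)
      have h2 : Real.log m - Real.log (m - 1) ≤ 1 / (m - 1) := by
        rw [← Real.log_div (by linarith) hpos.ne']
        refine (Real.log_le_sub_one_of_pos (by positivity)).trans (le_of_eq ?_)
        field_simp
        ring
      refine ⟨mul_nonneg (sq_nonneg _) (by linarith), ?_⟩
      calc (m - 1) ^ 2 * (Real.log m - Real.log (m - 1)) ≤ (m - 1) ^ 2 * (1 / (m - 1)) :=
            mul_le_mul_of_nonneg_left h2 (sq_nonneg _)
        _ = m - 1 := by field_simp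
        _ ≤ m := by linarith
  have hml : Real.log m ≤ m * Real.log m := le_mul_of_one_le_left hl0 hm
  refine ⟨by nlinarith, abs_le.mpr ⟨by nlinarith, by nlinarith⟩⟩

/-- The sum of the first `n` primes is asymptotic to `n ^ 2 log n / 2`. -/
theorem primeSum_isEquivalent :
    primeSum ~[atTop] fun n : ℕ => (n : ℝ) ^ 2 * Real.log n / 2 := by
  set a : ℕ → ℝ := fun n => (n : ℝ) ^ 2 * Real.log n / 2 with ha
  have hb : ∀ i : ℕ, ((i + 1 : ℕ) : ℝ) * Real.log (i + 1 : ℕ) ≤ 2 * (a (i + 1) - a i) ∧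
      |((i + 1 : ℕ) : ℝ) * Real.log (i + 1 : ℕ) - (a (i + 1) - a i)| ≤ (i + 1 : ℕ) := by
    intro i
    have h := sq_mul_log_increment_bounds (m := ((i + 1 : ℕ) : ℝ)) (by simp)
    have hi : ((i + 1 : ℕ) : ℝ) - 1 = i := by push_cast; ring
    rwa [hi] at h
  have hb0 : ∀ i : ℕ, 0 ≤ a (i + 1) - a i := by
    intro i
    have h0 : 0 ≤ ((i + 1 : ℕ) : ℝ) * Real.log (i + 1 : ℕ) :=
      mul_nonneg (Nat.cast_nonneg _) (Real.log_natCast_nonneg _)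
    linarith [(hb i).1]
  have hsum : ∀ n, ∑ i ∈ Finset.range n, (a (i + 1) - a i) = a n := by
    intro n
    rw [Finset.sum_range_sub]
    simp [ha]
  have hshift := tendsto_add_atTop_nat 1
  have hdiff : (fun i : ℕ => (nthPrime (i + 1) : ℝ) - (a (i + 1) - a i)) =o[atTop]
      fun i => a (i + 1) - a i := by
    have h1 := nthPrime_isEquivalent.isLittleO.comp_tendsto hshift
    have h2 : (fun i : ℕ => ((i + 1 : ℕ) : ℝ) * Real.log (i + 1 : ℕ) - (a (i + 1) - a i))
        =o[atTop] fun i : ℕ => ((i + 1 : ℕ) : ℝ) * Real.log (i + 1 : ℕ) := by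
      refine IsBigO.trans_isLittleO (.of_bound 1 (Eventually.of_forall fun i => ?_))
        (natCast_isLittleO_mul_log.comp_tendsto hshift)
      rw [Function.comp_apply, one_mul, Real.norm_of_nonneg (Nat.cast_nonneg _)]
      exact (hb i).2
    have h3 : (fun i : ℕ => ((i + 1 : ℕ) : ℝ) * Real.log (i + 1 : ℕ)) =O[atTop]
        fun i => a (i + 1) - a i := by
      refine .of_bound 2 (Eventually.of_forall fun i => ?_)
      rw [Real.norm_of_nonneg (hb0 i), Real.norm_of_nonneg
        (mul_nonneg (Nat.cast_nonneg _) (Real.log_natCast_nonneg _))]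
      exact (hb i).1
    refine ((h1.add h2).trans_isBigO h3).congr_left fun i => ?_
    simp
  have hatop : Tendsto a atTop atTop := by
    refine tendsto_atTop_mono' _ ?_
      ((Real.tendsto_log_atTop.comp tendsto_natCast_atTop_atTop).atTop_div_const zero_lt_two)
    filter_upwards [eventually_ge_atTop 1] with n hn
    have hn' : (1 : ℝ) ≤ n := Nat.one_le_cast.mpr hn
    have : Real.log n ≤ (n : ℝ) ^ 2 * Real.log n :=
      le_mul_of_one_le_left (Real.log_natCast_nonneg n) (one_le_pow₀ hn')
    simp only [ha, Function.comp_apply]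
    linarith
  -- Little-o relations may be summed because the comparison terms are nonnegative with divergent
  -- partial sums, here telescoping to `a n`.
  have hmain := hdiff.sum_range hb0 (by simpa only [hsum] using hatop)
  simp only [hsum] at hmain
  refine hmain.congr_left fun n => ?_
  rw [Finset.sum_sub_distrib, hsum, Pi.sub_apply, primeSum, Finset.range_eq_Ico,
    Finset.sum_Ico_add' (fun m => (nthPrime m : ℝ)) 0 n 1]
  rfl

theorem nthPrime_succ_isEquivalent :
    (fun n : ℕ => (nthPrime (n + 1) : ℝ)) ~[atTop] fun n : ℕ => (n : ℝ) * Real.log n := by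
  have h1 := nthPrime_isEquivalent.comp_tendsto (tendsto_add_atTop_nat 1)
  have h2 : (fun n : ℕ => ((n + 1 : ℕ) : ℝ)) ~[atTop] fun n : ℕ => (n : ℝ) := by
    have h : (fun _ : ℕ => (1 : ℝ)) =o[atTop] fun n : ℕ => (n : ℝ) :=
      (isLittleO_one_left_iff ℝ).mpr (tendsto_norm_atTop_atTop.comp tendsto_natCast_atTop_atTop)
    exact h.congr_left fun n => by simp
  exact h1.trans (h2.mul (h2.log tendsto_natCast_atTop_atTop))

/-! ### The limit -/

theorem tendsto_log_div_nthPrime_mul_primeSum :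
    Tendsto (fun n : ℕ =>
        Real.log (n : ℝ) / ((nthPrime n : ℝ) * (nthPrime (n + 1) : ℝ)) * primeSum n)
      atTop (𝓝 (1 / 2 : ℝ)) := by
  have h := ((IsEquivalent.refl (u := fun n : ℕ => Real.log (n : ℝ)) (l := atTop)).div
    (nthPrime_isEquivalent.mul nthPrime_succ_isEquivalent)).mul primeSum_isEquivalent
  refine h.symm.tendsto_nhds (tendsto_const_nhds.congr' ?_)
  filter_upwards [eventually_gt_atTop 1] with n hn
  have hn' : (1 : ℝ) < n := Nat.one_lt_cast.mpr hn
  have hlog := Real.log_pos hn'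
  simp only [Pi.mul_apply, Pi.div_apply]
  field_simp

theorem proposition1p1 :
    Filter.Tendsto
      (fun n : ℕ =>
        Real.log (n : ℝ) / ((nthPrime n : ℝ) - (nthPrime (n + 1) : ℝ)) *
          (1 / (nthPrime (n + 1) : ℝ) * primeSum n - 1 / (nthPrime n : ℝ) * primeSum n))
      Filter.atTop (nhds (1 / 2 : ℝ)) ∧
    Filter.Tendsto
      (fun n : ℕ =>
        Real.log (n : ℝ) / ((nthPrime n : ℝ) * (nthPrime (n + 1) : ℝ)) * primeSum n)
      Filter.atTop (nhds (1 / 2 : ℝ)) := by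
  refine ⟨tendsto_log_div_nthPrime_mul_primeSum.congr' ?_, tendsto_log_div_nthPrime_mul_primeSum⟩
  -- At n = 0 truncated subtraction makes `nthPrime 0 = nthPrime 1`, so the cancelled difference is
  -- nonzero only from n = 1 on.
  filter_upwards [eventually_ge_atTop 1] with n hn
  have hlt : nthPrime n < nthPrime (n + 1) :=
    Nat.nth_strictMono Nat.infinite_setOfPred_prime (by omega)
  have hlt' : (nthPrime n : ℝ) < nthPrime (n + 1) := Nat.cast_lt.mpr hlt
  have hpos : (0 : ℝ) < nthPrime n := Nat.cast_pos.mpr (Nat.prime_nth_prime _).pos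
  have hpos' : (0 : ℝ) < nthPrime (n + 1) := hpos.trans hlt'
  have hne : (nthPrime n : ℝ) - nthPrime (n + 1) ≠ 0 := by linarith
  field_simp
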